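/- Let $\mathcal M=(X,P,E,s_{init},L)$ be a finite continuous-time Markov chain ($P(s,\cdot)$ is a probability distribution on the finite state set $X$ for each $s$, $E$ the positive exit rates, $L$ a labeling) with a goal state $g$ that is absorbing, i.e. $P(g,g)=1$. Assume that from every state some absorbing state is reachable. (This is the case, for instance, if all states from which $g$ is not reachable have been collapsed into a single absorbing fail state.) For $m\in\mathbb N$ let $$p_m=\sum_{\substack{s_0=s_{init},\ s_m=g\\ s_i\neq g\ (0\le i<m)}}\ \prod_{i=0}^{m-1}P(s_i,s_{i+1})$$ be the probability to reach $g$ after exactly $m$ discrete steps. Enumerate the states by $1,\dots,n$, let $\mathbf P$ be the transition probability matrix, and let $u$ and $v$ be the numbers of $s_{init}$ and $g$ (with the usual numbering, $u=1$ and $v=n$). Let $a_{\mathbf P}$ be the (algebraic) multiplicity of the eigenvalue $1$ of $\mathbf P$. Let $\mathbf P=\mathbf S\mathbf J\mathbf S^{-1}$ over $\mathbb C$ be any Jordan decomposition, where $\mathbf J$ is block diagonal with Jordan blocks $\mathbf J_1,\dots,\mathbf J_q$, the block $\mathbf J_l$ having size $r_l\ge1$ and eigenvalue $\lambda_l$ (with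 $\lambda_l$ on the diagonal and $1$ directly above it), ordered such that $|\lambda_1|\ge|\lambda_2|\ge\dots\ge|\lambda_q|$. Let $h_l=\sum_{i=1}^{l-1}r_i$ and let $z$ be the number of Jordan blocks for the eigenvalue $0$. Then $z\in\{0,\dots,q-1\}$, and for every $N\in\mathbb N=\{0,1,2,\dots\}$ $$p_{N+1}=\sum_{l=a_{\mathbf P}+1}^{q-z}\ \sum_{j=1}^{r_l}\sum_{k=1}^{j}\mathbf S_{u,k+h_l}\,\mathbf S^{-1}_{j+h_l,v}\,\lambda_l^{N+k-j}\left(\lambda_l\binom{N+1}{j-k}-\binom{N}{j-k}\right)+R(N,z),$$ where $$R(N,z)=\sum_{l=q-z+1}^{q}\ \sum_{j=0}^{r_l-(N+1)}\left(\mathbf S^*_{u,h_l+j}-\mathbf S_{u,h_l+j+1}\right)\mathbf S^{-1}_{h_l+N+j+1,\,v},$$ with $\mathbf S^*_{u,h_l+j}=\mathbf S_{u,h_l+j}$ if $j>0$ and $\mathbf S^*_{u,h_l+j}=0$ if $j=0$. Moreover, $R(N,z)=0$ if $z=0$, or if $N\ge r_l$ for every Jordan block $\mathbf J_l$ with eigenvalue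 $0$. -/

import Mathlib

/-- A finite continuous-time Markov chain `(X, P, E, init, L)` with state space `X`: transition
probabilities `P`, positive exit rates `E`, an initial state, and a labeling of the states by sets
of atomic propositions. -/
structure CTMC (X AP : Type*) [Fintype X] where
  P : X → X → ℝ
  P_nonneg : ∀ s t, 0 ≤ P s t
  P_sum : ∀ s, ∑ t, P s t = 1
  E : X → ℝ
  E_pos : ∀ s, 0 < E s
  init : X
  label : X → Set AP

namespace CTMC

variable {X AP : Type*} [Fintype X]

/-- A state is absorbing if it is never left. -/
def IsAbsorbing (M : CTMC X AP) (s : X) : Prop := M.P s s = 1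

/-- `t` is reachable from `s` along transitions of positive probability (in any number of steps). -/
def Reachable (M : CTMC X AP) (s t : X) : Prop :=
  Relation.ReflTransGen (fun a b => 0 < M.P a b) s t

open Classical in
/-- The finite paths `s₀ s₁ … sₘ` with `s₀` the initial state, `sₘ = g`, and `sᵢ ≠ g` for `i < m`. -/
noncomputable def firstPassagePaths (M : CTMC X AP) (g : X) (m : ℕ) : Finset (Fin (m + 1) → X) :=
  {π | π 0 = M.init ∧ π (Fin.last m) = g ∧ ∀ i : Fin m, π i.castSucc ≠ g}

/-- The probability `P(s₀,s₁) ⋯ P(sₘ₋₁,sₘ)` of following the finite path `s₀ s₁ … sₘ`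
when starting in `s₀`. -/
def pathProb (M : CTMC X AP) {m : ℕ} (π : Fin (m + 1) → X) : ℝ :=
  ∏ i : Fin m, M.P (π i.castSucc) (π i.succ)

/-- The probability `pₘ` of reaching `g` (for the first time) after exactly `m` discrete steps,
starting in the initial state. -/
noncomputable def hitProb (M : CTMC X AP) (g : X) (m : ℕ) : ℝ :=
  ∑ π ∈ M.firstPassagePaths g m, M.pathProb π

/-- The transition probability matrix, as a complex matrix, for the enumeration `e` of the states. -/
noncomputable def transitionMatrix (M : CTMC X AP) {n : ℕ} (e : X ≃ Fin n) :
    Matrix (Fin n) (Fin n) ℂ :=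
  Matrix.of fun a b => (M.P (e.symm a) (e.symm b) : ℂ)

end CTMC

/-- The Jordan block of size `r` for `μ`: `μ` on the diagonal, `1` directly above it, `0` elsewhere. -/
def jordanBlock (r : ℕ) (μ : ℂ) : Matrix (Fin r) (Fin r) ℂ :=
  Matrix.of fun i j => if i = j then μ else if (i : ℕ) + 1 = (j : ℕ) then 1 else 0

/-- The `j`-th row (or column) of the `l`-th diagonal block, as a row (or column) of the whole matrix,
for consecutive blocks of sizes `r 0, …, r (q - 1)` with total size `n`. -/
def blockEquiv {q n : ℕ} (r : Fin q → ℕ) (h : ∑ l, r l = n) : ((l : Fin q) × Fin (r l)) ≃ Fin n :=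
  finSigmaFinEquiv.trans (finCongr h)

/-- The `j`-th row of block `l` is row number `h_l + j`, where `h_l` is the sum of the sizes of
the preceding blocks. -/
theorem blockEquiv_val {q n : ℕ} (r : Fin q → ℕ) (h : ∑ l, r l = n) (l : Fin q) (j : Fin (r l)) :
    (blockEquiv r h ⟨l, j⟩ : ℕ) = (∑ i : Fin q with i < l, r i) + (j : ℕ) := by
  have key : ∑ i : Fin (l : ℕ), r (Fin.castLE l.2.le i) = ∑ i : Fin q with i < l, r i := by
    refine Finset.sum_bij (fun i _ => Fin.castLE l.2.le i) ?_ ?_ ?_ ?_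
    · intro i _
      exact Finset.mem_filter.2 ⟨Finset.mem_univ _, i.2⟩
    · intro a _ b _ hab
      simpa using hab
    · intro b hb
      have hb' : b < l := by simpa using hb
      exact ⟨⟨b, hb'⟩, Finset.mem_univ _, rfl⟩
    · intro i _
      rfl
  simp [blockEquiv, finSigmaFinEquiv_apply, key]

/-- A Jordan decomposition `A = S J S⁻¹`, with the `q` Jordan blocks of `J` (of sizes `r l` and for
the eigenvalues `lam l`) in descending order of the absolute values of their eigenvalues. -/
structure JordanDecomposition {n : ℕ} (A : Matrix (Fin n) (Fin n) ℂ) where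
  q : ℕ
  r : Fin q → ℕ
  lam : Fin q → ℂ
  r_pos : ∀ l, 0 < r l
  r_sum : ∑ l, r l = n
  S : Matrix (Fin n) (Fin n) ℂ
  S_isUnit : IsUnit S
  eq : A = S * Matrix.reindex (blockEquiv r r_sum) (blockEquiv r r_sum)
      (Matrix.blockDiagonal' fun l => jordanBlock (r l) (lam l)) * S⁻¹
  norm_antitone : ∀ l l', l ≤ l' → ‖lam l'‖ ≤ ‖lam l‖

namespace JordanDecomposition

variable {n : ℕ} {A : Matrix (Fin n) (Fin n) ℂ}

/-- The index `h_l + j` of the `j`-th row or column of the `l`-th block (all indices from `0`). -/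
def pos (D : JordanDecomposition A) (l : Fin D.q) (j : Fin (D.r l)) : Fin n :=
  blockEquiv D.r D.r_sum ⟨l, j⟩

open Classical in
/-- The number `z` of Jordan blocks for the eigenvalue `0`. -/
noncomputable def z (D : JordanDecomposition A) : ℕ :=
  Finset.card {l : Fin D.q | D.lam l = 0}

/-- The sum over the Jordan blocks `l = a + 1, …, q - z` (counted from `1`) of the terms
`S_{u,k+h_l} S⁻¹_{j+h_l,v} λ_l ^ (N+k-j) (λ_l C(N+1,j-k) - C(N,j-k))`, `1 ≤ k ≤ j ≤ r_l`.
The exponent `N+k-j` may be negative. Indices in the code start at `0`. -/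
noncomputable def mainSum (D : JordanDecomposition A) (u v : Fin n) (a N : ℕ) : ℂ :=
  ∑ l ∈ Finset.univ.filter (fun l : Fin D.q => a ≤ (l : ℕ) ∧ (l : ℕ) < D.q - D.z),
    ∑ j : Fin (D.r l), ∑ k : Fin (D.r l) with k ≤ j,
      D.S u (D.pos l k) * D.S⁻¹ (D.pos l j) v * D.lam l ^ ((N : ℤ) + ((k : ℕ) : ℤ) - ((j : ℕ) : ℤ)) *
        (D.lam l * ((N + 1).choose ((j : ℕ) - (k : ℕ)) : ℂ) - (N.choose ((j : ℕ) - (k : ℕ)) : ℂ))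

/-- The correction term
`R(N,z) = ∑_{l=q-z+1}^{q} ∑_{j=0}^{r_l-(N+1)} (S*_{u,h_l+j} - S_{u,h_l+j+1}) S⁻¹_{h_l+N+j+1,v}`
(indices from `1`), where `S*_{u,h_l+j}` is `0` for `j = 0` and `S_{u,h_l+j}` for `j > 0`.
Since indices in the code start at `0`, all row and column numbers are smaller by one. -/
noncomputable def R (D : JordanDecomposition A) (u v : Fin n) (N : ℕ) : ℂ :=
  ∑ l ∈ Finset.univ.filter (fun l : Fin D.q => D.q - D.z ≤ (l : ℕ)),
    ∑ j : Fin (D.r l - N),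
      ((if (j : ℕ) = 0 then 0 else D.S u (D.pos l ⟨(j : ℕ) - 1, by omega⟩))
        - D.S u (D.pos l ⟨(j : ℕ), by omega⟩)) * D.S⁻¹ (D.pos l ⟨N + (j : ℕ), by omega⟩) v

end JordanDecomposition

/-! Since `g` is absorbing, `p_{N+1}` is the `(u,v)` entry of `P^(N+1) - P^N`. Conjugating by `S`
turns this entry into a sum over Jordan blocks. A block with `λ ≠ 0` contributes binomial terms; a
block with `λ = 0` is a nilpotent shift, and its two shifted diagonals combine into `R`
(`sum_jordanBlock_zero_pow_succ_sub`).

It remains to see that the first `a_P` blocks are those with eigenvalue `1` and that they contribute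
nothing. Both follow from `P^(N+1) - P^N → 0`: this forces `λ = 1` whenever `|λ| ≥ 1`, and size `1`
for every block with `λ = 1`. The convergence is probabilistic: the mass on non-absorbing states
tends to `0` by a maximum principle, and the mass in each absorbing state is monotone in `N`. -/

open Filter Topology

/-! ### First passage and convergence of the powers of the chain -/

namespace CTMC

variable {X AP : Type*} [Fintype X]

/-- The transition probabilities as a real matrix indexed by the states. -/
def stepMatrix (M : CTMC X AP) : Matrix X X ℝ := Matrix.of M.P

theorem hitProb_zero (M : CTMC X AP) [DecidableEq X] (g : X) :
    M.hitProb g 0 = if M.init = g then 1 else 0 := by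
  classical
  unfold hitProb firstPassagePaths pathProb
  rw [Finset.sum_filter]
  rw [← (Equiv.funUnique (Fin 1) X).symm.sum_comp]
  simp only [Equiv.funUnique_symm_apply, uniqueElim_const, Fin.last, IsEmpty.forall_iff, and_true,
    Finset.univ_eq_empty, Finset.prod_empty]
  rw [Finset.sum_eq_single M.init]
  · simp
  · intro b _ hb
    simp [hb]
  · simp

/-- First-step analysis: removing the first state of a path leaves a first-passage path of the same
chain restarted at its second state. -/
theorem hitProb_succ (M : CTMC X AP) [DecidableEq X] (g : X) (m : ℕ) :
    M.hitProb g (m + 1) = if M.init = g then 0 else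
      ∑ t, M.P M.init t * ({M with init := t} : CTMC X AP).hitProb g m := by
  classical
  unfold hitProb firstPassagePaths pathProb
  simp only [Finset.sum_filter, Finset.mul_sum]
  rw [← (Fin.consEquiv (fun _ : Fin (m + 2) => X)).sum_comp, Fintype.sum_prod_type,
    Finset.sum_eq_single M.init]
  · split_ifs with hg
    · refine Finset.sum_eq_zero fun π _ => if_neg ?_
      rintro ⟨-, -, h⟩
      exact h 0 (by simpa [Fin.consEquiv] using hg)
    · rw [Finset.sum_comm]
      refine Finset.sum_congr rfl fun π _ => ?_
      rw [Finset.sum_eq_single (π 0)]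
      · simp only [Fin.consEquiv, Equiv.coe_fn_mk, Fin.forall_fin_succ (n := m),
          Fin.prod_univ_succ (n := m), Fin.castSucc_zero, Fin.cons_zero, Fin.cons_succ,
          ← Fin.succ_castSucc, ← Fin.succ_last, hg, ne_eq, not_false_eq_true, true_and, mul_ite,
          mul_zero]
      · intro t _ ht
        simp [ht.symm]
      · simp
  · intro s _ hs
    refine Finset.sum_eq_zero fun π _ => if_neg ?_
    rintro ⟨h, -⟩
    exact hs (by simpa [Fin.consEquiv] using h)
  · simp

theorem IsAbsorbing.P_eq (M : CTMC X AP) [DecidableEq X] {s : X} (hs : M.IsAbsorbing s) (t : X) :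
    M.P s t = if s = t then 1 else 0 := by
  split_ifs with h
  · rw [← h]; exact hs
  · have h1 := M.P_sum s
    rw [← Finset.add_sum_erase _ _ (Finset.mem_univ s), show M.P s s = 1 from hs,
      add_eq_left, Finset.sum_eq_zero_iff_of_nonneg fun t _ => M.P_nonneg s t] at h1
    exact h1 t (by simp [Ne.symm h])

theorem IsAbsorbing.stepMatrix_pow (M : CTMC X AP) [DecidableEq X] {s : X}
    (hs : M.IsAbsorbing s) (N : ℕ) (t : X) :
    (M.stepMatrix ^ N) s t = if s = t then 1 else 0 := by
  induction N generalizing t with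
  | zero => simp [Matrix.one_apply]
  | succ N ih =>
    rw [pow_succ, Matrix.mul_apply]
    simp only [ih, ite_mul, one_mul, zero_mul, Finset.sum_ite_eq, Finset.mem_univ, if_true]
    exact hs.P_eq M t

/-- Hitting an absorbing state after exactly `N + 1` steps means to be there after `N + 1` steps,
but not after `N` steps. -/
theorem hitProb_succ_eq_sub (M : CTMC X AP) [DecidableEq X] {g : X} (hg : M.IsAbsorbing g)
    (N : ℕ) : M.hitProb g (N + 1) =
      (M.stepMatrix ^ (N + 1)) M.init g - (M.stepMatrix ^ N) M.init g := by
  -- The first step changes the initial state, so the chain itself must vary in the induction.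
  induction N generalizing M with
  | zero =>
    rw [hitProb_succ]
    simp only [hitProb_zero]
    split_ifs with h
    · simp [h, stepMatrix, show M.P g g = 1 from hg]
    · simp [h, stepMatrix]
  | succ N ih =>
    rw [hitProb_succ]
    split_ifs with h
    · rw [h, hg.stepMatrix_pow, hg.stepMatrix_pow, sub_self]
    · rw [pow_succ' _ (N + 1), pow_succ' _ N, Matrix.mul_apply, Matrix.mul_apply,
        ← Finset.sum_sub_distrib]
      refine Finset.sum_congr rfl fun t _ => ?_
      rw [ih {M with init := t} hg, mul_sub, ← pow_succ']
      rfl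

theorem stepMatrix_pow_nonneg (M : CTMC X AP) [DecidableEq X] (N : ℕ) (s t : X) :
    0 ≤ (M.stepMatrix ^ N) s t := by
  induction N generalizing t with
  | zero => rw [pow_zero, Matrix.one_apply]; split_ifs <;> norm_num
  | succ N ih =>
    rw [pow_succ, Matrix.mul_apply]
    exact Finset.sum_nonneg fun x _ => mul_nonneg (ih x) (M.P_nonneg x t)

theorem sum_stepMatrix_pow (M : CTMC X AP) [DecidableEq X] (N : ℕ) (s : X) :
    ∑ t, (M.stepMatrix ^ N) s t = 1 := by
  induction N with
  | zero => simp [Matrix.one_apply]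
  | succ N ih =>
    simp_rw [pow_succ, Matrix.mul_apply]
    rw [Finset.sum_comm]
    have h : ∀ x, ∑ t, M.stepMatrix x t = 1 := M.P_sum
    simp only [← Finset.mul_sum, h, mul_one, ih]

theorem stepMatrix_pow_le_one (M : CTMC X AP) [DecidableEq X] (N : ℕ) (s t : X) :
    (M.stepMatrix ^ N) s t ≤ 1 :=
  (Finset.single_le_sum (fun x _ => M.stepMatrix_pow_nonneg N s x) (Finset.mem_univ t)).trans_eq
    (M.sum_stepMatrix_pow N s)

/-- Maximum principle: a harmonic function that vanishes on the absorbing states is nonpositive,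
if an absorbing state is reachable from every state. -/
theorem harmonic_nonpos (M : CTMC X AP) (habs : ∀ s, ∃ t, M.IsAbsorbing t ∧ M.Reachable s t)
    {f : X → ℝ} (hf : ∀ s, f s = ∑ t, M.P s t * f t) (hf0 : ∀ s, M.IsAbsorbing s → f s = 0)
    (s : X) : f s ≤ 0 := by
  have : Nonempty X := ⟨s⟩
  obtain ⟨x, hx⟩ := Finite.exists_max f
  -- If the weighted average at `a` equals the maximum, every value with positive weight is maximal.
  have hstep : ∀ a b, f a = f x → 0 < M.P a b → f b = f x := by
    intro a b ha hab
    have h0 : ∑ t, M.P a t * (f x - f t) = 0 := by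
      simp_rw [mul_sub, Finset.sum_sub_distrib, ← Finset.sum_mul, M.P_sum, ← hf a, ha]
      ring
    rw [Finset.sum_eq_zero_iff_of_nonneg
      fun t _ => mul_nonneg (M.P_nonneg a t) (sub_nonneg.2 (hx t))] at h0
    have := (mul_eq_zero.1 (h0 b (Finset.mem_univ b))).resolve_left hab.ne'
    linarith
  have hreach : ∀ y, M.Reachable x y → f y = f x := fun y hy => by
    induction hy with
    | refl => rfl
    | tail _ hab ih => exact hstep _ _ ih hab
  obtain ⟨t, ht, hxt⟩ := habs x
  have hft := hreach t hxt
  exact (hx s).trans (by rw [← hft, hf0 t ht])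

open Classical in
/-- The probability to be in a state that is not absorbing after `N` steps, starting in `s`. -/
noncomputable def transientMass (M : CTMC X AP) (N : ℕ) (s : X) : ℝ :=
  ∑ t with ¬ M.IsAbsorbing t, (M.stepMatrix ^ N) s t

theorem transientMass_nonneg (M : CTMC X AP) (N : ℕ) (s : X) : 0 ≤ M.transientMass N s := by
  classical
  exact Finset.sum_nonneg fun _ _ => M.stepMatrix_pow_nonneg N s _

theorem transientMass_le_one (M : CTMC X AP) (N : ℕ) (s : X) : M.transientMass N s ≤ 1 := by
  classical
  exact (Finset.sum_le_univ_sum_of_nonneg fun t => M.stepMatrix_pow_nonneg N s t).trans_eq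
    (M.sum_stepMatrix_pow N s)

theorem transientMass_succ (M : CTMC X AP) (N : ℕ) (s : X) :
    M.transientMass (N + 1) s = ∑ t, M.P s t * M.transientMass N t := by
  classical
  simp only [transientMass, pow_succ', Matrix.mul_apply, Finset.mul_sum]
  rw [Finset.sum_comm]
  rfl

theorem IsAbsorbing.transientMass_eq_zero (M : CTMC X AP) {s : X} (hs : M.IsAbsorbing s) (N : ℕ) :
    M.transientMass N s = 0 := by
  classical
  refine Finset.sum_eq_zero fun t ht => ?_
  rw [hs.stepMatrix_pow, if_neg]
  rintro rfl
  exact (Finset.mem_filter.1 ht).2 hs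

theorem transientMass_antitone (M : CTMC X AP) (s : X) :
    Antitone fun N => M.transientMass N s := by
  classical
  refine antitone_nat_of_succ_le fun N => ?_
  induction N generalizing s with
  | zero =>
    by_cases hs : M.IsAbsorbing s
    · simp [hs.transientMass_eq_zero]
    · refine (M.transientMass_le_one 1 s).trans_eq ?_
      rw [transientMass, Finset.sum_eq_single s]
      · simp
      · intro t _ hts
        rw [pow_zero, Matrix.one_apply_ne' hts]
      · simp [hs]
  | succ N ih =>
    rw [transientMass_succ, M.transientMass_succ N]
    exact Finset.sum_le_sum fun t _ => mul_le_mul_of_nonneg_left (ih t) (M.P_nonneg s t)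

/-- The mass decreases in `N`, so it has a limit. Passing to the limit in the first-step recursion
makes this limit harmonic; it vanishes on absorbing states, so the maximum principle applies. -/
theorem tendsto_transientMass (M : CTMC X AP)
    (habs : ∀ s, ∃ t, M.IsAbsorbing t ∧ M.Reachable s t) (s : X) :
    Tendsto (fun N => M.transientMass N s) atTop (𝓝 0) := by
  have hlim : ∀ s, ∃ x, Tendsto (fun N => M.transientMass N s) atTop (𝓝 x) := fun s =>
    ⟨_, tendsto_atTop_ciInf (M.transientMass_antitone s)
      ⟨0, by rintro _ ⟨N, rfl⟩; exact M.transientMass_nonneg N s⟩⟩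
  choose f hf using hlim
  have h1 : ∀ s, f s = ∑ t, M.P s t * f t := fun s => by
    refine tendsto_nhds_unique ((tendsto_add_atTop_iff_nat 1).2 (hf s)) ?_
    simp_rw [transientMass_succ]
    exact tendsto_finsetSum _ fun t _ => (hf t).const_mul _
  have h2 : ∀ s, M.IsAbsorbing s → f s = 0 := fun s hs => by
    refine tendsto_nhds_unique (hf s) ?_
    simp [hs.transientMass_eq_zero]
  have h3 : f s = 0 := le_antisymm (M.harmonic_nonpos habs h1 h2 s)
    (ge_of_tendsto' (hf s) fun N => M.transientMass_nonneg N s)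
  exact h3 ▸ hf s

theorem exists_tendsto_stepMatrix_pow (M : CTMC X AP) [DecidableEq X]
    (habs : ∀ s, ∃ t, M.IsAbsorbing t ∧ M.Reachable s t) (s t : X) :
    ∃ x, Tendsto (fun N => (M.stepMatrix ^ N) s t) atTop (𝓝 x) := by
  -- Mass in an absorbing state never leaves, so its column increases; any other column is dominated
  -- by the transient mass.
  by_cases ht : M.IsAbsorbing t
  · refine ⟨_, tendsto_atTop_ciSup (monotone_nat_of_le_succ fun N => ?_)
      ⟨1, by rintro _ ⟨N, rfl⟩; exact M.stepMatrix_pow_le_one N s t⟩⟩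
    rw [pow_succ, Matrix.mul_apply]
    refine le_trans (le_of_eq ?_) (Finset.single_le_sum
      (fun x _ => mul_nonneg (M.stepMatrix_pow_nonneg N s x) (M.P_nonneg x t)) (Finset.mem_univ t))
    rw [show M.P t t = 1 from ht, mul_one]
  · refine ⟨0, squeeze_zero (fun N => M.stepMatrix_pow_nonneg N s t) (fun N => ?_)
      (M.tendsto_transientMass habs s)⟩
    classical
    refine (Finset.single_le_sum (f := fun t => (M.stepMatrix ^ N) s t)
      (s := {t | ¬ M.IsAbsorbing t}) (fun x _ => M.stepMatrix_pow_nonneg N s x)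
      (Finset.mem_filter.2 ⟨Finset.mem_univ t, ht⟩)).trans_eq ?_
    unfold transientMass
    congr!

theorem transitionMatrix_pow_apply (M : CTMC X AP) [DecidableEq X] {n : ℕ} (e : X ≃ Fin n) (N : ℕ)
    (a b : Fin n) :
    (M.transitionMatrix e ^ N) a b = ((M.stepMatrix ^ N) (e.symm a) (e.symm b) : ℂ) := by
  induction N generalizing b with
  | zero => simp [Matrix.one_apply, apply_ite]
  | succ N ih =>
    rw [pow_succ, pow_succ, Matrix.mul_apply, Matrix.mul_apply, ← e.sum_comp]
    push_cast
    refine Finset.sum_congr rfl fun x _ => ?_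
    rw [ih, e.symm_apply_apply]
    simp [transitionMatrix, stepMatrix]

theorem tendsto_transitionMatrix_pow_sub (M : CTMC X AP)
    (habs : ∀ s, ∃ t, M.IsAbsorbing t ∧ M.Reachable s t) {n : ℕ} (e : X ≃ Fin n) :
    Tendsto (fun N => M.transitionMatrix e ^ (N + 1) - M.transitionMatrix e ^ N) atTop (𝓝 0) := by
  classical
  refine tendsto_pi_nhds.2 fun a => tendsto_pi_nhds.2 fun b => ?_
  obtain ⟨x, hx⟩ := M.exists_tendsto_stepMatrix_pow habs (e.symm a) (e.symm b)
  simp only [Matrix.sub_apply, transitionMatrix_pow_apply, Matrix.zero_apply]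
  have := ((tendsto_add_atTop_iff_nat 1).2 hx).sub hx
  rw [sub_self] at this
  exact_mod_cast (Complex.continuous_ofReal.tendsto 0).comp this

end CTMC

/-! ### Powers of Jordan blocks -/

theorem jordanBlock_pow_apply (r : ℕ) (μ : ℂ) (N : ℕ) (k j : Fin r) :
    (jordanBlock r μ ^ N) k j =
      if k ≤ j then (N.choose ((j : ℕ) - k) : ℂ) * μ ^ (N - ((j : ℕ) - k)) else 0 := by
  induction N generalizing k with
  | zero =>
    rw [pow_zero, Matrix.one_apply]
    rcases lt_trichotomy k j with h | h | h
    · have : (j : ℕ) - k = (j - k - 1) + 1 := by have : (k : ℕ) < j := h; omega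
      rw [if_neg h.ne, if_pos h.le, this]; simp
    · simp [h]
    · rw [if_neg h.ne', if_neg h.not_ge]
  | succ N ih =>
    rw [pow_succ', Matrix.mul_apply]
    by_cases hk : (k : ℕ) + 1 < r
    · have hsum : ∀ f : Fin r → ℂ, ∑ x, jordanBlock r μ k x * f x = μ * f k + f ⟨k + 1, hk⟩ := by
        intro f
        rw [Finset.sum_eq_add k ⟨k + 1, hk⟩ (by simp [Fin.ext_iff])]
        · simp [jordanBlock, Fin.ext_iff]
        · intro c _ hc
          have h1 : ¬ k = c := fun h => hc.1 h.symm
          have h2 : ¬ (k : ℕ) + 1 = c := fun h => hc.2 (Fin.ext h.symm)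
          simp [jordanBlock, h1, h2]
        · simp
        · simp
      rw [hsum, ih, ih]
      rcases lt_trichotomy k j with h | h | h
      · obtain ⟨d, hd⟩ : ∃ d, (j : ℕ) = k + d + 1 := ⟨j - k - 1, by have : (k : ℕ) < j := h; omega⟩
        have h1 : (⟨k + 1, hk⟩ : Fin r) ≤ j := Fin.mk_le_of_le_val (by omega)
        rw [if_pos h.le, if_pos h.le, if_pos h1]
        have e1 : (j : ℕ) - k = d + 1 := by omega
        have e2 : (j : ℕ) - (k + 1) = d := by omega
        simp only [e1, e2, Nat.choose_succ_succ, Nat.add_sub_add_right]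
        -- Pascal's rule has split the binomial. The exponents match directly for `d < N`; otherwise
        -- subtraction truncates, but the affected binomial is zero.
        rcases lt_or_ge d N with hN | hN
        · have : N - d = N - (d + 1) + 1 := by omega
          rw [this]; push_cast; ring
        · rw [Nat.choose_eq_zero_of_lt (show N < d + 1 by omega)]; simp
      · subst h
        have h1 : ¬ (⟨k + 1, hk⟩ : Fin r) ≤ k := by simp [Fin.le_def]
        rw [if_neg h1]
        simp [pow_succ']
      · have h1 : ¬ (⟨k + 1, hk⟩ : Fin r) ≤ j := by
          have : (j : ℕ) < k := h
          simp only [Fin.le_def]; omega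
        simp [h.not_ge, h1]
    · have hsum : ∀ f : Fin r → ℂ, ∑ x, jordanBlock r μ k x * f x = μ * f k := by
        intro f
        rw [Finset.sum_eq_single k]
        · simp [jordanBlock]
        · intro c _ hc
          have h2 : ¬ (k : ℕ) + 1 = c := by omega
          simp [jordanBlock, hc.symm, h2]
        · simp
      rw [hsum, ih]
      by_cases h : k ≤ j
      · have : k = j := by have : (k : ℕ) ≤ j := h; omega
        subst this
        simp [pow_succ']
      · simp [h]

/-! ### Block expansion of the powers and spectral constraints -/

namespace JordanDecomposition

variable {n : ℕ} {A : Matrix (Fin n) (Fin n) ℂ}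

theorem charpoly_eq (D : JordanDecomposition A) :
    A.charpoly = ∏ l, (Polynomial.X - Polynomial.C (D.lam l)) ^ D.r l := by
  conv_lhs => rw [D.eq]
  rw [Matrix.charpoly_mul_comm, ← mul_assoc,
    Matrix.nonsing_inv_mul _ ((Matrix.isUnit_iff_isUnit_det _).1 D.S_isUnit), one_mul,
    Matrix.charpoly_of_isUpperTriangular, ← (blockEquiv D.r D.r_sum).prod_comp,
    Fintype.prod_sigma]
  · simp [jordanBlock]
  · intro i j hij
    obtain ⟨⟨l, a⟩, rfl⟩ := (blockEquiv D.r D.r_sum).surjective i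
    obtain ⟨⟨l', b⟩, rfl⟩ := (blockEquiv D.r D.r_sum).surjective j
    rcases eq_or_ne l l' with rfl | hl
    · have h : (blockEquiv D.r D.r_sum ⟨l, b⟩ : ℕ) < blockEquiv D.r D.r_sum ⟨l, a⟩ := hij
      rw [blockEquiv_val, blockEquiv_val] at h
      have h1 : ¬ a = b := by rintro rfl; omega
      have h2 : ¬ (a : ℕ) + 1 = b := by omega
      simp [jordanBlock, h1, h2]
    · simp [Matrix.blockDiagonal'_apply, hl]

theorem rootMultiplicity_charpoly (D : JordanDecomposition A) (μ : ℂ) :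
    A.charpoly.rootMultiplicity μ = ∑ l with D.lam l = μ, D.r l := by
  classical
  rw [← Polynomial.count_roots, D.charpoly_eq, Polynomial.roots_prod]
  · simp [Multiset.count_bind, Multiset.count_singleton, Finset.sum_filter, eq_comm,
      List.sum_ofFn]
  · exact Finset.prod_ne_zero_iff.2 fun l _ => pow_ne_zero _ (Polynomial.X_sub_C_ne_zero _)

theorem inv_mul_S (D : JordanDecomposition A) : D.S⁻¹ * D.S = 1 :=
  Matrix.nonsing_inv_mul _ ((Matrix.isUnit_iff_isUnit_det _).1 D.S_isUnit)

theorem pow_eq (D : JordanDecomposition A) (N : ℕ) :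
    A ^ N = D.S * Matrix.reindex (blockEquiv D.r D.r_sum) (blockEquiv D.r D.r_sum)
      (Matrix.blockDiagonal' fun l => jordanBlock (D.r l) (D.lam l) ^ N) * D.S⁻¹ := by
  have h : ∀ B : Matrix (Fin n) (Fin n) ℂ, (D.S * B * D.S⁻¹) ^ N = D.S * B ^ N * D.S⁻¹ := by
    intro B
    induction N with
    | zero =>
      simp [Matrix.mul_nonsing_inv _ ((Matrix.isUnit_iff_isUnit_det _).1 D.S_isUnit)]
    | succ N ih =>
      rw [pow_succ, ih, pow_succ]
      calc _ = D.S * B ^ N * (D.S⁻¹ * D.S) * B * D.S⁻¹ := by simp only [mul_assoc]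
        _ = _ := by rw [D.inv_mul_S]; simp only [mul_assoc, one_mul]
  conv_lhs => rw [D.eq]
  rw [h]
  congr 2
  have := map_pow (Matrix.reindexAlgEquiv ℂ ℂ (blockEquiv D.r D.r_sum))
    (Matrix.blockDiagonal' fun l => jordanBlock (D.r l) (D.lam l)) N
  rw [← Matrix.blockDiagonal'_pow] at this
  exact this.symm

theorem pow_apply (D : JordanDecomposition A) (N : ℕ) (u v : Fin n) :
    (A ^ N) u v = ∑ l, ∑ j, ∑ k, D.S u (D.pos l k) *
      (jordanBlock (D.r l) (D.lam l) ^ N) k j * D.S⁻¹ (D.pos l j) v := by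
  rw [D.pow_eq, Matrix.mul_apply, ← (blockEquiv D.r D.r_sum).sum_comp, Fintype.sum_sigma]
  refine Finset.sum_congr rfl fun l _ => Finset.sum_congr rfl fun j _ => ?_
  rw [Matrix.mul_apply, ← (blockEquiv D.r D.r_sum).sum_comp, Fintype.sum_sigma, Finset.sum_mul,
    Finset.sum_eq_single l]
  · rw [Finset.sum_mul]
    refine Finset.sum_congr rfl fun k _ => ?_
    simp [pos, Matrix.blockDiagonal'_apply]
  · intro l' _ hl
    rw [Finset.sum_eq_zero, zero_mul]
    intro k _
    simp [Matrix.blockDiagonal'_apply, hl]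
  · simp

theorem jordanBlock_pow_eq (D : JordanDecomposition A) (N : ℕ) (l : Fin D.q) (k j : Fin (D.r l)) :
    (jordanBlock (D.r l) (D.lam l) ^ N) k j = (D.S⁻¹ * A ^ N * D.S) (D.pos l k) (D.pos l j) := by
  rw [D.pow_eq]
  have : ∀ B : Matrix (Fin n) (Fin n) ℂ, D.S⁻¹ * (D.S * B * D.S⁻¹) * D.S = B := fun B =>
    calc _ = (D.S⁻¹ * D.S) * B * (D.S⁻¹ * D.S) := by simp only [mul_assoc]
      _ = B := by rw [D.inv_mul_S, one_mul, mul_one]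
  rw [this]
  simp [pos, Matrix.blockDiagonal'_apply]

theorem tendsto_jordanBlock_pow_sub (D : JordanDecomposition A)
    (hA : Tendsto (fun N => A ^ (N + 1) - A ^ N) atTop (𝓝 0)) (l : Fin D.q) (k j : Fin (D.r l)) :
    Tendsto (fun N => (jordanBlock (D.r l) (D.lam l) ^ (N + 1)) k j -
      (jordanBlock (D.r l) (D.lam l) ^ N) k j) atTop (𝓝 0) := by
  have hc : Continuous fun B : Matrix (Fin n) (Fin n) ℂ =>
      (D.S⁻¹ * B * D.S) (D.pos l k) (D.pos l j) := by fun_prop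
  have := (hc.tendsto 0).comp hA
  simp only [Matrix.mul_zero, Matrix.zero_mul, Matrix.zero_apply] at this
  refine this.congr fun N => ?_
  rw [jordanBlock_pow_eq, jordanBlock_pow_eq, ← Matrix.sub_apply]
  simp [mul_sub, sub_mul]

/-- A diagonal entry of the block difference is `λ^N (λ - 1)`, of norm at least `|λ - 1|`, yet it
tends to `0`. -/
theorem lam_eq_one_of_one_le_norm (D : JordanDecomposition A)
    (hA : Tendsto (fun N => A ^ (N + 1) - A ^ N) atTop (𝓝 0)) {l : Fin D.q}
    (hl : 1 ≤ ‖D.lam l‖) : D.lam l = 1 := by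
  have h := D.tendsto_jordanBlock_pow_sub hA l ⟨0, D.r_pos l⟩ ⟨0, D.r_pos l⟩
  simp only [jordanBlock_pow_apply, le_refl, if_true, Nat.sub_self, Nat.choose_zero_right,
    Nat.cast_one, one_mul, Nat.sub_zero] at h
  have h2 : ‖D.lam l - 1‖ ≤ 0 := by
    refine ge_of_tendsto' (by simpa using h.norm) fun N => ?_
    rw [show D.lam l ^ (N + 1) - D.lam l ^ N = D.lam l ^ N * (D.lam l - 1) by ring, norm_mul,
      norm_pow]
    exact le_mul_of_one_le_left (norm_nonneg _) (one_le_pow₀ hl)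
  exact sub_eq_zero.1 (norm_le_zero_iff.1 h2)

/-- In a larger block the entry just above the diagonal of `J^(N+1) - J^N` would be `(N + 1) - N =
1` for all `N`. -/
theorem r_eq_one_of_lam_eq_one (D : JordanDecomposition A)
    (hA : Tendsto (fun N => A ^ (N + 1) - A ^ N) atTop (𝓝 0)) {l : Fin D.q}
    (hl : D.lam l = 1) : D.r l = 1 := by
  by_contra hr
  have hr' : 1 < D.r l := by have := D.r_pos l; omega
  have h := D.tendsto_jordanBlock_pow_sub hA l ⟨0, D.r_pos l⟩ ⟨1, hr'⟩
  simp [jordanBlock_pow_apply, hl] at h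

theorem rootMultiplicity_one_charpoly (D : JordanDecomposition A)
    (hA : Tendsto (fun N => A ^ (N + 1) - A ^ N) atTop (𝓝 0)) :
    A.charpoly.rootMultiplicity 1 = Finset.card {l : Fin D.q | D.lam l = 1} := by
  rw [D.rootMultiplicity_charpoly, Finset.card_eq_sum_ones]
  exact Finset.sum_congr rfl fun l hl =>
    D.r_eq_one_of_lam_eq_one hA (Finset.mem_filter.1 hl).2

end JordanDecomposition

/-- A lower set of `Fin q` is an initial segment. -/
theorem Fin.val_lt_card_filter_iff {q : ℕ} {p : Fin q → Prop} [DecidablePred p]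
    (hp : ∀ l l', l ≤ l' → p l' → p l) (l : Fin q) :
    (l : ℕ) < Finset.card {l : Fin q | p l} ↔ p l := by
  constructor
  · intro h
    by_contra hl
    have hsub : Finset.univ.filter (fun l => p l) ⊆ Finset.Iio l := fun x hx => by
      rw [Finset.mem_Iio]
      by_contra hx'
      exact hl (hp l x (not_lt.1 hx') (Finset.mem_filter.1 hx).2)
    have := Finset.card_le_card hsub
    rw [Fin.card_Iio] at this
    omega
  · intro h
    have hsub : Finset.Iic l ⊆ Finset.univ.filter (fun l => p l) := fun x hx =>
      Finset.mem_filter.2 ⟨Finset.mem_univ x, hp x l (Finset.mem_Iic.1 hx) h⟩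
    have := Finset.card_le_card hsub
    rw [Fin.card_Iic] at this
    omega

/-! ### Positions of the eigenvalues 1 and 0 in the ordering -/

namespace JordanDecomposition

variable {n : ℕ} {A : Matrix (Fin n) (Fin n) ℂ}

theorem lt_rootMultiplicity_iff (D : JordanDecomposition A)
    (hA : Tendsto (fun N => A ^ (N + 1) - A ^ N) atTop (𝓝 0)) (l : Fin D.q) :
    (l : ℕ) < A.charpoly.rootMultiplicity 1 ↔ D.lam l = 1 := by
  rw [D.rootMultiplicity_one_charpoly hA]
  refine Fin.val_lt_card_filter_iff (p := fun l => D.lam l = 1) (fun l l' h h1 => ?_) l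
  -- Any block preceding one with eigenvalue `1` has modulus at least `1`, hence eigenvalue `1` too.
  refine D.lam_eq_one_of_one_le_norm hA ?_
  have := D.norm_antitone l l' h
  rwa [h1, norm_one] at this

theorem lt_q_sub_z_iff (D : JordanDecomposition A) (l : Fin D.q) :
    (l : ℕ) < D.q - D.z ↔ D.lam l ≠ 0 := by
  classical
  have h : D.q - D.z = Finset.card {l : Fin D.q | D.lam l ≠ 0} := by
    have := Finset.card_filter_add_card_filter_not (s := (Finset.univ : Finset (Fin D.q)))
      (fun l => D.lam l = 0)
    rw [Finset.card_univ, Fintype.card_fin] at this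
    have hz : D.z = Finset.card {l : Fin D.q | D.lam l = 0} := by unfold z; congr
    rw [hz]
    exact Nat.sub_eq_of_eq_add' this.symm
  rw [h]
  refine Fin.val_lt_card_filter_iff (p := fun l => D.lam l ≠ 0) (fun l l' h h1 h0 => h1 ?_) l
  have := D.norm_antitone l l' h
  rw [h0, norm_zero] at this
  exact norm_le_zero_iff.1 this

theorem pow_succ_sub_pow_apply (D : JordanDecomposition A) (N : ℕ) (u v : Fin n) :
    (A ^ (N + 1)) u v - (A ^ N) u v = ∑ l, ∑ j, ∑ k, D.S u (D.pos l k) * D.S⁻¹ (D.pos l j) v *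
      ((jordanBlock (D.r l) (D.lam l) ^ (N + 1)) k j -
        (jordanBlock (D.r l) (D.lam l) ^ N) k j) := by
  simp only [D.pow_apply, ← Finset.sum_sub_distrib]
  refine Finset.sum_congr rfl fun l _ => Finset.sum_congr rfl fun j _ =>
    Finset.sum_congr rfl fun k _ => ?_
  ring

end JordanDecomposition

/-! ### Contributions of nonzero and of nilpotent blocks -/

theorem jordanBlock_pow_succ_sub_of_ne_zero {r : ℕ} {μ : ℂ} (hμ : μ ≠ 0) (N : ℕ) (k j : Fin r) :
    (jordanBlock r μ ^ (N + 1)) k j - (jordanBlock r μ ^ N) k j =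
      if k ≤ j then μ ^ ((N : ℤ) + ((k : ℕ) : ℤ) - ((j : ℕ) : ℤ)) *
        (μ * ((N + 1).choose ((j : ℕ) - k) : ℂ) - (N.choose ((j : ℕ) - k) : ℂ)) else 0 := by
  -- Truncated and integer exponents differ only for `d > m`, where the binomial vanishes.
  have key : ∀ m d : ℕ, (m.choose d : ℂ) * μ ^ (m - d) = m.choose d * μ ^ ((m : ℤ) - d) := by
    intro m d
    rcases le_or_gt d m with h | h
    · rw [← zpow_natCast, Nat.cast_sub h]
    · simp [Nat.choose_eq_zero_of_lt h]
  rw [jordanBlock_pow_apply, jordanBlock_pow_apply]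
  split_ifs with h
  · have h' : (k : ℕ) ≤ j := h
    rw [key, key]
    have e1 : ((N : ℤ) + ((k : ℕ) : ℤ) - ((j : ℕ) : ℤ)) = N - ((j - k : ℕ) : ℤ) := by omega
    have e2 : (((N + 1 : ℕ) : ℤ) - ((j - k : ℕ) : ℤ)) = N - ((j - k : ℕ) : ℤ) + 1 := by omega
    rw [e1, e2, zpow_add_one₀ hμ]
    ring
  · simp

theorem jordanBlock_zero_pow_apply {r : ℕ} (N : ℕ) (k j : Fin r) :
    (jordanBlock r 0 ^ N) k j = if (k : ℕ) + N = j then 1 else 0 := by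
  rw [jordanBlock_pow_apply]
  by_cases h : k ≤ j
  · have h' : (k : ℕ) ≤ j := h
    rw [if_pos h]
    rcases lt_trichotomy ((j : ℕ) - k) N with h1 | h1 | h1
    · rw [if_neg (by omega), zero_pow (by omega), mul_zero]
    · rw [if_pos (by omega), h1]; simp
    · rw [if_neg (by omega), Nat.choose_eq_zero_of_lt h1]; simp
  · have h' : ¬ (k : ℕ) ≤ j := h
    rw [if_neg h, if_neg (by omega)]

theorem Fin.sum_sum_ite_add_eq {r : ℕ} (N : ℕ) (f : Fin r → Fin r → ℂ) :
    ∑ j : Fin r, ∑ k : Fin r, (if (k : ℕ) + N = j then f k j else 0) =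
      ∑ i : Fin (r - N), f ⟨i, by omega⟩ ⟨N + i, by omega⟩ := by
  -- Extension by zero to `ℕ` turns sums over different `Fin` types into range sums.
  let F : ℕ → ℂ := fun i => if h : N + i < r then f ⟨i, by omega⟩ ⟨N + i, h⟩ else 0
  have h1 : ∀ k : Fin r, ∑ j : Fin r, (if (k : ℕ) + N = j then f k j else 0) = F k := by
    intro k
    by_cases h : N + (k : ℕ) < r
    · rw [Finset.sum_eq_single ⟨N + k, h⟩]
      · simp [F, h, add_comm]
      · intro j _ hj
        exact if_neg fun h' => hj (Fin.ext (by simp only; omega))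
      · simp
    · simp only [F, dif_neg h]
      exact Finset.sum_eq_zero fun j _ => if_neg (by omega)
  have h2 : ∀ i : Fin (r - N), f ⟨i, by omega⟩ ⟨N + i, by omega⟩ = F i := fun i => by
    simp only [F, dif_pos (show N + (i : ℕ) < r by omega)]
  rw [Finset.sum_comm]
  simp only [h1, h2]
  rw [Fin.sum_univ_eq_sum_range, Fin.sum_univ_eq_sum_range]
  refine (Finset.sum_subset (Finset.range_mono (Nat.sub_le r N)) fun i _ hi => dif_neg ?_).symm
  rw [Finset.mem_range] at hi
  omega

/-- The shift `j = i + 1` aligns the `(N+1)`-st superdiagonal with the `N`-th; the extra index `j =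
0` gets the value `0`, as in `S*`. -/
theorem Fin.sum_sub_succ_eq {r : ℕ} (N : ℕ) (a b : Fin r → ℂ) :
    ∑ i : Fin (r - (N + 1)), a ⟨i, by omega⟩ * b ⟨N + 1 + i, by omega⟩ =
      ∑ j : Fin (r - N), (if (j : ℕ) = 0 then 0 else a ⟨(j : ℕ) - 1, by omega⟩) *
        b ⟨N + (j : ℕ), by omega⟩ := by
  let G : ℕ → ℂ := fun j => if h : N + j < r then
    (if j = 0 then 0 else a ⟨j - 1, by omega⟩) * b ⟨N + j, h⟩ else 0
  have h1 : ∀ i : Fin (r - (N + 1)), a ⟨i, by omega⟩ * b ⟨N + 1 + i, by omega⟩ = G (i + 1) := by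
    intro i
    simp only [G, dif_pos (show N + ((i : ℕ) + 1) < r by omega), Nat.add_one_ne_zero, if_false,
      Nat.add_sub_cancel]
    congr 3
    omega
  have h2 : ∀ j : Fin (r - N), (if (j : ℕ) = 0 then 0 else a ⟨(j : ℕ) - 1, by omega⟩) *
      b ⟨N + (j : ℕ), by omega⟩ = G j := fun j => by
    simp only [G, dif_pos (show N + (j : ℕ) < r by omega)]
  simp only [h1, h2]
  rw [Fin.sum_univ_eq_sum_range (fun i => G (i + 1)), Fin.sum_univ_eq_sum_range, ← Nat.sub_sub]
  rcases r - N with _ | m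
  · simp
  · rw [Finset.sum_range_succ']
    simp [G]

theorem sum_jordanBlock_zero_pow_succ_sub {r : ℕ} (N : ℕ) (a b : Fin r → ℂ) :
    ∑ j, ∑ k, a k * b j * ((jordanBlock r 0 ^ (N + 1)) k j - (jordanBlock r 0 ^ N) k j) =
      ∑ j : Fin (r - N), ((if (j : ℕ) = 0 then 0 else a ⟨(j : ℕ) - 1, by omega⟩) -
        a ⟨(j : ℕ), by omega⟩) * b ⟨N + (j : ℕ), by omega⟩ := by
  simp only [jordanBlock_zero_pow_apply, mul_sub, Finset.sum_sub_distrib, mul_ite, mul_one,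
    mul_zero, sub_mul, Fin.sum_sum_ite_add_eq N fun k j => a k * b j,
    Fin.sum_sum_ite_add_eq (N + 1) fun k j => a k * b j, ← Fin.sum_sub_succ_eq]

/-! ### Assembly of the formula -/

namespace JordanDecomposition

variable {n : ℕ} {A : Matrix (Fin n) (Fin n) ℂ}

theorem pow_succ_sub_pow_apply_eq (D : JordanDecomposition A)
    (hA : Tendsto (fun N => A ^ (N + 1) - A ^ N) atTop (𝓝 0)) (N : ℕ) (u v : Fin n) :
    (A ^ (N + 1)) u v - (A ^ N) u v =
      D.mainSum u v (A.charpoly.rootMultiplicity 1) N + D.R u v N := by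
  rw [D.pow_succ_sub_pow_apply, mainSum, R, Finset.sum_filter, Finset.sum_filter,
    ← Finset.sum_add_distrib]
  refine Finset.sum_congr rfl fun l _ => ?_
  simp only [← not_lt (a := (_ : ℕ)), D.lt_rootMultiplicity_iff hA, D.lt_q_sub_z_iff, not_not]
  by_cases h0 : D.lam l = 0
  · rw [if_neg (by simp [h0]), if_pos h0, zero_add, h0]
    exact sum_jordanBlock_zero_pow_succ_sub N (fun k => D.S u (D.pos l k))
      (fun j => D.S⁻¹ (D.pos l j) v)
  · rw [if_neg h0, add_zero]
    simp only [jordanBlock_pow_succ_sub_of_ne_zero h0]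
    -- The block is the scalar `1`, so its successive powers cancel.
    by_cases h1 : D.lam l = 1
    · rw [if_neg (by simp [h1])]
      have hr := D.r_eq_one_of_lam_eq_one hA h1
      refine Finset.sum_eq_zero fun j _ => Finset.sum_eq_zero fun k _ => ?_
      have hj : (j : ℕ) = 0 := by omega
      have hk : (k : ℕ) = 0 := by omega
      simp [hj, hk, h1]
    · rw [if_pos ⟨h1, h0⟩]
      refine Finset.sum_congr rfl fun j _ => ?_
      rw [Finset.sum_filter]
      refine Finset.sum_congr rfl fun k _ => ?_
      by_cases h : k ≤ j
      · rw [if_pos h, if_pos h]; ring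
      · rw [if_neg h, if_neg h, mul_zero]

theorem R_eq_zero (D : JordanDecomposition A) (u v : Fin n) {N : ℕ}
    (h : ∀ l : Fin D.q, D.lam l = 0 → D.r l ≤ N) : D.R u v N = 0 := by
  refine Finset.sum_eq_zero fun l hl => ?_
  have h0 : D.lam l = 0 := by
    by_contra h0
    exact absurd ((D.lt_q_sub_z_iff l).2 h0) (not_lt.2 (Finset.mem_filter.1 hl).2)
  have : IsEmpty (Fin (D.r l - N)) := by
    rw [Nat.sub_eq_zero_of_le (h l h0)]
    infer_instance
  exact Finset.sum_of_isEmpty _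

theorem z_lt_q_of_pow_ne_zero (D : JordanDecomposition A) (hA : ∀ N, A ^ N ≠ 0) : D.z < D.q := by
  by_contra hz
  -- If all eigenvalues were `0`, the `n`-th power would vanish, as no block is larger than `n`.
  refine hA n (Matrix.ext fun u v => ?_)
  rw [D.pow_apply, Matrix.zero_apply]
  refine Finset.sum_eq_zero fun l _ => Finset.sum_eq_zero fun j _ =>
    Finset.sum_eq_zero fun k _ => ?_
  have h0 : D.lam l = 0 := by
    by_contra h0
    have := (D.lt_q_sub_z_iff l).2 h0
    omega
  have hr : D.r l ≤ n :=
    (Finset.single_le_sum (fun _ _ => Nat.zero_le _) (Finset.mem_univ l)).trans_eq D.r_sum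
  rw [h0, jordanBlock_zero_pow_apply, if_neg (by omega), mul_zero, zero_mul]

end JordanDecomposition

theorem mainTheorem10 {X AP : Type*} [Fintype X] (M : CTMC X AP) (g : X)
    (hg : M.IsAbsorbing g)
    (habs : ∀ s, ∃ t, M.IsAbsorbing t ∧ M.Reachable s t)
    {n : ℕ} (e : X ≃ Fin n) (D : JordanDecomposition (M.transitionMatrix e)) (N : ℕ) :
    D.z < D.q ∧
    (M.hitProb g (N + 1) : ℂ) =
      D.mainSum (e M.init) (e g) ((M.transitionMatrix e).charpoly.rootMultiplicity 1) N
        + D.R (e M.init) (e g) N ∧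
    (D.z = 0 → D.R (e M.init) (e g) N = 0) ∧
    ((∀ l : Fin D.q, D.lam l = 0 → D.r l ≤ N) → D.R (e M.init) (e g) N = 0) := by
  classical
  refine ⟨D.z_lt_q_of_pow_ne_zero fun N h => ?_, ?_, fun hz => D.R_eq_zero _ _ fun l hl => ?_,
    D.R_eq_zero _ _⟩
  -- The diagonal entry at the absorbing state `g` is `1` in every power.
  · have := M.transitionMatrix_pow_apply e N (e g) (e g)
    rw [h, e.symm_apply_apply, hg.stepMatrix_pow] at this
    simp at this
  · rw [← D.pow_succ_sub_pow_apply_eq (M.tendsto_transitionMatrix_pow_sub habs e),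
      M.transitionMatrix_pow_apply, M.transitionMatrix_pow_apply, e.symm_apply_apply,
      e.symm_apply_apply, M.hitProb_succ_eq_sub hg]
    push_cast
    rfl
  · exact absurd hl ((D.lt_q_sub_z_iff l).1 (by omega))
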